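/- Consider a binary-input memoryless channel with input alphabet $\{+1,-1\}$ and real output, having output probability density $q^+$ (resp. $q^-$) given input $+1$ (resp. $-1$). Let $n\ge 1$ and let $(X_i,Y_i)$, $i=1,\dots,n$, be i.i.d. copies of $(X,Y)$, where $X$ is uniform on $\{+1,-1\}$ and $Y$ is the channel output for input $X$. Put $\mathrm{sgn}(t)=1$ if $t\ge 0$ and $\mathrm{sgn}(t)=-1$ otherwise, and $$L_i=\ln\frac{q^+(Y_i)}{q^-(Y_i)}\in[-\infty,\infty],\quad \Lambda_i=|L_i|,\quad E_i=\mathbf 1\bigl(\mathrm{sgn}(L_i)X_i<0\bigr),\quad R_i=\sum_{j=1}^n\mathbf 1(\Lambda_j\le\Lambda_i),$$ so that $R_i$ is the rank (from $1$, the smallest, to $n$) of $\Lambda_i$ among $\Lambda_1,\dots,\Lambda_n$ when there are no ties. Let $\Psi$ be the cumulative distribution function of $\Lambda_1$, let $\mu=\mathbb E[\Psi(\Lambda_1)E_1]$, and let $$D(\underline X,\underline Y)=\frac1n\sum_{i=1}^n\frac{R_i}{n}E_i$$ be the ORBGRAND decoding metric. Then, for every $\delta>0$ such that $[\mu-\delta,\mu+\delta]\subset(0,1/4)$,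 $$\Pr\bigl[D(\underline X,\underline Y)\notin[\mu-\delta,\mu+\delta]\bigr]\le 4\exp\Bigl(-\frac{n\delta^2}{2}\Bigr).$$ -/

import Mathlib

open MeasureTheory ProbabilityTheory
open scoped ENNReal

noncomputable section

namespace ORBGRAND

/-- A memoryless channel with input alphabet `{+1, -1}` and real output, given by the probability
density functions (with respect to Lebesgue measure) of the output when the input is `+1`
respectively `-1`. -/
structure BinaryInputChannel where
  /-- output density given the input `+1` -/
  qPos : ℝ → ℝ
  /-- output density given the input `-1` -/
  qNeg : ℝ → ℝ
  measurable_qPos : Measurable qPos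
  measurable_qNeg : Measurable qNeg
  qPos_nonneg : ∀ y, 0 ≤ qPos y
  qNeg_nonneg : ∀ y, 0 ≤ qNeg y
  lintegral_qPos : ∫⁻ y, ENNReal.ofReal (qPos y) = 1
  lintegral_qNeg : ∫⁻ y, ENNReal.ofReal (qNeg y) = 1

/-- The convention `sgn t = 1` if `t ≥ 0` and `-1` otherwise. -/
def sgn (t : EReal) : ℤ := if 0 ≤ t then 1 else -1

/-- The rank (from `1`, the smallest, to `n`, the largest) of the `i`-th entry of a vector of
reliabilities, as `∑ j, 1(lam j ≤ lam i)`. -/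
def rank {n : ℕ} (lam : Fin n → ℝ≥0∞) (i : Fin n) : ℕ :=
  (Finset.univ.filter fun j => lam j ≤ lam i).card

namespace BinaryInputChannel

variable (W : BinaryInputChannel)

/-- The joint law of one channel input `X`, uniform on `{+1, -1}`, and its channel output `Y`. -/
def letterLaw : Measure (ℤ × ℝ) :=
  (2⁻¹ : ℝ≥0∞) •
      (volume.withDensity fun y => ENNReal.ofReal (W.qPos y)).map (fun y => ((1 : ℤ), y)) +
    (2⁻¹ : ℝ≥0∞) •
      (volume.withDensity fun y => ENNReal.ofReal (W.qNeg y)).map (fun y => ((-1 : ℤ), y))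

/-- The log-likelihood ratio `ln (q⁺(y) / q⁻(y))`, with value `+∞` where only `q⁻` vanishes and
`-∞` where only `q⁺` vanishes (the set where both vanish has probability zero). -/
def llr (y : ℝ) : EReal :=
  ENNReal.log (ENNReal.ofReal (W.qPos y) / ENNReal.ofReal (W.qNeg y))

/-- The reliability `Λ = |L|`. -/
def reliability (y : ℝ) : ℝ≥0∞ := (W.llr y).abs

/-- The cumulative distribution function `Ψ` of the reliability `Λ`. -/
def reliabilityCDF (t : ℝ≥0∞) : ℝ := W.letterLaw.real {p | W.reliability p.2 ≤ t}

/-- The indicator `E = 1(sgn(L) X < 0)` of a hard-decision error. -/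
def errorInd (x : ℤ) (y : ℝ) : ℝ := if sgn (W.llr y) * x < 0 then 1 else 0

/-- `μ = E[V]`, where `V = Ψ(Λ) E`. -/
def mu : ℝ := ∫ p, W.reliabilityCDF (W.reliability p.2) * W.errorInd p.1 p.2 ∂W.letterLaw

/-- The ORBGRAND decoding metric `D(x, y) = (1/n) ∑ i, (r_i / n) 1(sgn(l_i) x_i < 0)`. -/
def metric {n : ℕ} (x : Fin n → ℤ) (y : Fin n → ℝ) : ℝ :=
  (1 / (n : ℝ)) *
    ∑ i, ((rank (fun j => W.reliability (y j)) i : ℝ) / (n : ℝ)) * W.errorInd (x i) (y i)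

end BinaryInputChannel

end ORBGRAND

end

namespace ORBGRAND

open scoped NNReal

/-! The metric is `n⁻²` times a double sum of a `[0, 1]`-valued kernel `φ(Z i, Z j)`. Off the
diagonal each term has mean exactly `μ`, so the mean of the metric is within `1/n` of `μ`.

For the fluctuations, split the pairs `(i, j)` by the residue `r = i + j` mod `n`. Each class is the
graph of the involution `i ↦ r - i`, whose orbits use disjoint sets of variables, so the orbit sums
are independent and Hoeffding's lemma gives proxy `n / 2` (`hasSubgaussianMGF_sum_involution`).
Adding the `n` dependent classes costs a factor `n²` (`hasSubgaussianMGF_sum_card_sq`). The Chernoff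
bound is then `2 exp(-n t²)` with `t = δ - 1/n`, and the constant 4 absorbs the shift. -/

/-- A sum over a finite linear order, grouped along the orbits of an involution. -/
lemma sum_eq_sum_orbits {ι : Type*} [Fintype ι] [LinearOrder ι] {τ : ι → ι}
    (hτ : Function.Involutive τ) (f : ι → ℝ) :
    ∑ i, f i = ∑ i with i ≤ τ i, if i = τ i then f i else f i + f (τ i) := by
  have hsplit : ∀ i, (if i = τ i then f i else f i + f (τ i)) =
      f i + if i = τ i then 0 else f (τ i) := by
    intro i; split_ifs <;> simp
  rw [← Finset.sum_filter_add_sum_filter_not Finset.univ (fun i => i ≤ τ i) f]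
  simp only [hsplit, Finset.sum_add_distrib]
  congr 1
  rw [Finset.sum_ite, Finset.sum_const_zero, zero_add, Finset.filter_filter]
  refine Finset.sum_nbij' τ τ ?_ ?_ (fun i _ => hτ i) (fun i _ => hτ i) (fun i _ => by rw [hτ i])
  · intro i hi
    simp only [Finset.mem_filter, Finset.mem_univ, true_and, hτ i, not_le] at hi ⊢
    exact ⟨hi.le, hi.ne⟩
  · intro i hi
    simp only [Finset.mem_filter, Finset.mem_univ, true_and, hτ i, not_le] at hi ⊢
    exact lt_of_le_of_ne hi.1 hi.2

/-! ### Sub-Gaussian bounds for double sums -/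

section Subgaussian

variable {Ω : Type*} {mΩ : MeasurableSpace Ω} {P : Measure Ω}

lemma hasSubgaussianMGF_mono {X : Ω → ℝ} {c d : ℝ≥0} (h : HasSubgaussianMGF X c P)
    (hcd : c ≤ d) : HasSubgaussianMGF X d P where
  integrable_exp_mul := h.integrable_exp_mul
  mgf_le t := (h.mgf_le t).trans <| Real.exp_le_exp.mpr <| by gcongr

/-- A sum of `k` sub-Gaussian variables, not assumed independent, is sub-Gaussian with `k ^ 2`
times their variance proxy. -/
lemma hasSubgaussianMGF_sum_card_sq [IsProbabilityMeasure P] {ι : Type*} {X : ι → Ω → ℝ}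
    {c : ℝ≥0} (s : Finset ι) (h : ∀ i ∈ s, HasSubgaussianMGF (X i) c P) :
    HasSubgaussianMGF (fun ω => ∑ i ∈ s, X i ω) ((s.card : ℝ≥0) ^ 2 * c) P := by
  classical
  induction s using Finset.induction_on with
  | empty => simp
  | insert a s ha ih =>
    have h1 := (h a (Finset.mem_insert_self a s)).add
      (ih fun i hi => h i (Finset.mem_insert_of_mem hi))
    simp only [Finset.sum_insert ha]
    convert h1 using 1
    -- Without independence the square roots of the proxies add, giving `k * √c`.
    rw [NNReal.sqrt_mul, NNReal.sqrt_sq, Finset.card_insert_of_notMem ha]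
    have h2 : NNReal.sqrt c + s.card * NNReal.sqrt c = (s.card + 1) * NNReal.sqrt c := by ring
    rw [h2, mul_pow, NNReal.sq_sqrt]
    push_cast
    ring

variable {α : Type*} {mα : MeasurableSpace α} {ι : Type*} [DecidableEq ι] {Z : ι → Ω → α}

/-- Hoeffding's lemma for a sum of bounded functions of disjoint pairs of independent variables. -/
lemma hasSubgaussianMGF_sum_disjoint_pairs [IsProbabilityMeasure P]
    (hZ : ∀ i, AEMeasurable (Z i) P) (hind : iIndepFun Z P) {g : ι → α × α → ℝ}
    (hg : ∀ i, Measurable (g i)) {b : ι → ℝ} (hgb : ∀ i p, g i p ∈ Set.Icc 0 (b i)) (τ : ι → ι)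
    (s : Finset ι) (hs : ∀ i ∈ s, ∀ j ∈ s, i ≠ j → j ≠ τ i ∧ τ j ≠ i ∧ τ j ≠ τ i) :
    HasSubgaussianMGF
      (fun ω => ∑ i ∈ s, (g i (Z i ω, Z (τ i) ω) - P[fun ω => g i (Z i ω, Z (τ i) ω)]))
      (∑ i ∈ s, (‖b i - 0‖₊ / 2) ^ 2) P := by
  induction s using Finset.induction_on with
  | empty => simp
  | insert a s ha ih =>
    simp only [Finset.sum_insert ha]
    refine HasSubgaussianMGF.add_of_indepFun
      (hasSubgaussianMGF_of_mem_Icc (by fun_prop) (ae_of_all _ fun ω => hgb a _))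
      (ih fun i hi j hj => hs i (Finset.mem_insert_of_mem hi) j (Finset.mem_insert_of_mem hj)) ?_
    -- The new summand and the remaining sum depend on disjoint blocks of variables, hence are
    -- independent.
    have hdisj : Disjoint ({a, τ a} : Finset ι) (s ∪ s.image τ) := by
      rw [Finset.disjoint_left]
      intro x hx hx'
      have key : ∀ j ∈ s, j ≠ a ∧ j ≠ τ a ∧ τ j ≠ a ∧ τ j ≠ τ a := fun j hj =>
        have hne : a ≠ j := fun h => ha (h ▸ hj)
        ⟨hne.symm, hs a (Finset.mem_insert_self a s) j (Finset.mem_insert_of_mem hj) hne⟩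
      simp only [Finset.mem_insert, Finset.mem_singleton] at hx
      rcases Finset.mem_union.mp hx' with h | h
      · rcases hx with rfl | rfl
        · exact (key _ h).1 rfl
        · exact (key _ h).2.1 rfl
      · obtain ⟨j, hj, rfl⟩ := Finset.mem_image.mp h
        rcases hx with h | h
        · exact (key _ hj).2.2.1 h
        · exact (key _ hj).2.2.2 h
    have hF : Measurable fun z : (({a, τ a} : Finset ι) → α) =>
        g a (z ⟨a, by simp⟩, z ⟨τ a, by simp⟩) - P[fun ω => g a (Z a ω, Z (τ a) ω)] := by
      fun_prop
    have hG : Measurable fun z : ((s ∪ s.image τ : Finset ι) → α) => ∑ i ∈ s.attach,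
        (g i (z ⟨i, Finset.mem_union_left _ i.2⟩,
            z ⟨τ i, Finset.mem_union_right _ (Finset.mem_image_of_mem τ i.2)⟩) -
          P[fun ω => g i (Z i ω, Z (τ i) ω)]) := by
      fun_prop
    convert (hind.indepFun_finset₀ _ _ hdisj hZ).comp hF hG using 1
    · rfl
    · ext ω
      exact (Finset.sum_attach s fun i => g i (Z i ω, Z (τ i) ω) -
        P[fun ω => g i (Z i ω, Z (τ i) ω)]).symm

/-- The sum of a `[0, 1]`-valued kernel along an involution of independent variables. -/
lemma hasSubgaussianMGF_sum_involution [IsProbabilityMeasure P] {ι : Type*} [Fintype ι]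
    [LinearOrder ι] {Z : ι → Ω → α}
    (hZ : ∀ i, AEMeasurable (Z i) P) (hind : iIndepFun Z P) {φ : α × α → ℝ}
    (hφ : Measurable φ) (hφb : ∀ p, φ p ∈ Set.Icc 0 1) {τ : ι → ι}
    (hτ : Function.Involutive τ) :
    HasSubgaussianMGF
      (fun ω => ∑ i, (φ (Z i ω, Z (τ i) ω) - P[fun ω => φ (Z i ω, Z (τ i) ω)]))
      (Fintype.card ι / 2) P := by
  have hint : ∀ i j, Integrable (fun ω => φ (Z i ω, Z j ω)) P := fun i j =>
    Integrable.of_mem_Icc 0 1 (by fun_prop) (ae_of_all _ fun ω => hφb _)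
  have hsub := hasSubgaussianMGF_sum_disjoint_pairs hZ hind
    (g := fun i p => if i = τ i then φ p else φ p + φ p.swap)
    (b := fun i => if i = τ i then 1 else 2)
    (fun i => by split_ifs <;> fun_prop)
    (fun i p => by
      have h1 := hφb p
      have h2 := hφb p.swap
      simp only [Set.mem_Icc] at h1 h2 ⊢
      split_ifs <;> constructor <;> linarith)
    τ (Finset.univ.filter fun i => i ≤ τ i) (by
      intro i hi j hj hij
      simp only [Finset.mem_filter, Finset.mem_univ, true_and] at hi hj
      refine ⟨?_, ?_, fun h => hij (hτ.injective h).symm⟩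
      · rintro rfl
        rw [hτ i] at hj
        exact hij (le_antisymm hi hj)
      · rintro rfl
        rw [hτ j] at hi
        exact hij (le_antisymm hi hj))
  refine (hasSubgaussianMGF_mono hsub ?_).congr (ae_of_all _ fun ω => ?_)
  -- Charge 1/2 per index: a two-point orbit has range 2 and proxy 1, a fixed point has proxy 1/4 ≤
  -- 1/2.
  · have h := sum_eq_sum_orbits hτ fun _ => (1 / 2 : ℝ)
    rw [Finset.sum_const, Finset.card_univ, nsmul_eq_mul, mul_one_div] at h
    rw [← NNReal.coe_le_coe]
    push_cast
    rw [h]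
    refine Finset.sum_le_sum fun i _ => ?_
    split_ifs <;> norm_num
  · simp only
    rw [sum_eq_sum_orbits hτ]
    refine Finset.sum_congr rfl fun i _ => ?_
    split_ifs with hi
    · rfl
    · simp only [Prod.swap_prod_mk, hτ i]
      rw [integral_add (hint _ _) (hint _ _)]
      ring

/-- The centred double sum of a `[0, 1]`-valued kernel over independent variables. -/
lemma hasSubgaussianMGF_sum_sum [IsProbabilityMeasure P] {n : ℕ} {Z : Fin n → Ω → α}
    (hZ : ∀ i, AEMeasurable (Z i) P) (hind : iIndepFun Z P) {φ : α × α → ℝ}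
    (hφ : Measurable φ) (hφb : ∀ p, φ p ∈ Set.Icc 0 1) :
    HasSubgaussianMGF
      (fun ω => ∑ i, ∑ j, (φ (Z i ω, Z j ω) - P[fun ω => φ (Z i ω, Z j ω)]))
      ((n : ℝ≥0) ^ 2 * (n / 2)) P := by
  rcases Nat.eq_zero_or_pos n with rfl | hn
  · simp
  have : NeZero n := ⟨hn.ne'⟩
  have h := hasSubgaussianMGF_sum_card_sq (P := P) (c := (n : ℝ≥0) / 2)
    (Finset.univ : Finset (Fin n))
    (X := fun r ω => ∑ i, (φ (Z i ω, Z (r - i) ω) - P[fun ω => φ (Z i ω, Z (r - i) ω)]))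
    (fun r _ => by
      simpa using hasSubgaussianMGF_sum_involution hZ hind hφ hφb
        (τ := fun i => r - i) (fun i => sub_sub_cancel r i))
  rw [Finset.card_univ, Fintype.card_fin] at h
  refine h.congr (ae_of_all _ fun ω => ?_)
  simp only
  rw [Finset.sum_comm]
  refine Finset.sum_congr rfl fun i _ => ?_
  exact (Equiv.subRight i).sum_comp fun j => φ (Z i ω, Z j ω) - P[fun ω => φ (Z i ω, Z j ω)]

end Subgaussian

/-- Expanding the square, the shift by `1/n` costs at most `2δ < 1/4` in the exponent, and `exp
(1/4) ≤ 4/3 < 2`. -/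
lemma two_exp_le_four_exp {n δ : ℝ} (hn : 0 < n) (hδ : δ < 1 / 8) :
    2 * Real.exp (-(n * (δ - 1 / n) ^ 2)) ≤ 4 * Real.exp (-(n * δ ^ 2 / 2)) := by
  have hexp : n * (δ - 1 / n) ^ 2 = n * δ ^ 2 - 2 * δ + 1 / n := by
    field_simp
    ring
  have h1 : Real.exp (1 / 4) ≤ 2 := by
    have h := Real.exp_bound_div_one_sub_of_interval (x := 1 / 4) (by norm_num) (by norm_num)
    linarith
  calc 2 * Real.exp (-(n * (δ - 1 / n) ^ 2))
      ≤ 2 * Real.exp (1 / 4 + -(n * δ ^ 2 / 2)) := by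
        gcongr
        have h2 : 0 < 1 / n := by positivity
        have h3 : 0 ≤ n * δ ^ 2 := by positivity
        linarith
    _ ≤ 4 * Real.exp (-(n * δ ^ 2 / 2)) := by
        rw [Real.exp_add]
        nlinarith [Real.exp_pos (-(n * δ ^ 2 / 2))]

/-- Covers the `δ` too small to beat the bias, where the claimed bound exceeds 1: here `n δ² / 2 < δ
/ 2 < 1/16`. -/
lemma one_le_four_exp {n δ : ℝ} (hn : 0 < n) (hδ0 : 0 < δ) (hδ : δ < 1 / 8) (h : δ < 1 / n) :
    1 ≤ 4 * Real.exp (-(n * δ ^ 2 / 2)) := by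
  have h1 : n * δ < 1 := by rwa [lt_div_iff₀ hn, mul_comm] at h
  have h2 := Real.add_one_le_exp (-(n * δ ^ 2 / 2))
  nlinarith

/-! ### The decoding metric as a double sum, and its mean -/

namespace BinaryInputChannel

variable (W : BinaryInputChannel)

lemma measurable_llr : Measurable W.llr := by
  have h1 := W.measurable_qPos
  have h2 := W.measurable_qNeg
  unfold llr
  exact ENNReal.measurable_log.comp (by fun_prop)

lemma measurable_reliability : Measurable W.reliability :=
  (EReal.measurable_of_measurable_real (f := EReal.abs) (by
    simp only [EReal.abs_def]
    exact ENNReal.measurable_ofReal.comp measurable_id.abs)).comp W.measurable_llr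

lemma measurable_errorInd : Measurable fun p : ℤ × ℝ => W.errorInd p.1 p.2 := by
  have hsgn : Measurable fun p : ℤ × ℝ => sgn (W.llr p.2) := by
    unfold sgn
    exact Measurable.ite (measurableSet_le measurable_const (W.measurable_llr.comp measurable_snd))
      measurable_const measurable_const
  exact Measurable.ite (measurableSet_lt (hsgn.mul measurable_fst) measurable_const)
    measurable_const measurable_const

/-- The kernel `1(Λ' ≤ Λ) E` whose double sum over a codeword is the decoding metric. -/
noncomputable def metricKernel (p : (ℤ × ℝ) × (ℤ × ℝ)) : ℝ :=
  (if W.reliability p.2.2 ≤ W.reliability p.1.2 then 1 else 0) * W.errorInd p.1.1 p.1.2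

lemma measurable_metricKernel : Measurable W.metricKernel :=
  (Measurable.ite (measurableSet_le
    (W.measurable_reliability.comp (measurable_snd.comp measurable_snd))
    (W.measurable_reliability.comp (measurable_snd.comp measurable_fst)))
    measurable_const measurable_const).mul (W.measurable_errorInd.comp measurable_fst)

lemma metricKernel_mem_Icc (p : (ℤ × ℝ) × (ℤ × ℝ)) : W.metricKernel p ∈ Set.Icc (0 : ℝ) 1 := by
  unfold metricKernel errorInd
  split_ifs <;> simp

lemma metric_eq_sum_sum {n : ℕ} (x : Fin n → ℤ) (y : Fin n → ℝ) :
    W.metric x y = 1 / (n : ℝ) ^ 2 * ∑ i, ∑ j, W.metricKernel ((x i, y i), (x j, y j)) := by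
  simp only [metric, metricKernel, rank, ← Finset.sum_mul, Finset.sum_boole]
  rw [Finset.mul_sum, Finset.mul_sum]
  refine Finset.sum_congr rfl fun i _ => ?_
  ring

lemma integral_metricKernel [IsProbabilityMeasure W.letterLaw] :
    ∫ p, W.metricKernel p ∂(W.letterLaw.prod W.letterLaw) = W.mu := by
  rw [integral_prod _ (Integrable.of_mem_Icc 0 1 W.measurable_metricKernel.aemeasurable
    (ae_of_all _ W.metricKernel_mem_Icc))]
  refine integral_congr_ae (ae_of_all _ fun p => ?_)
  simp only [metricKernel]
  rw [integral_mul_const]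
  congr 1
  have hset : MeasurableSet {q : ℤ × ℝ | W.reliability q.2 ≤ W.reliability p.2} :=
    measurableSet_le (W.measurable_reliability.comp measurable_snd) measurable_const
  rw [reliabilityCDF, ← integral_indicator_one hset]
  simp only [Set.indicator_apply, Set.mem_ofPred_eq, Pi.one_apply]

section Concentration

variable {Ω : Type*} [MeasurableSpace Ω] {P : Measure Ω} [IsProbabilityMeasure P] {n : ℕ}
  {Z : Fin n → Ω → ℤ × ℝ}

lemma integral_metricKernel_of_ne (hlaw : ∀ i, HasLaw (Z i) W.letterLaw P) (hind : iIndepFun Z P)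
    {i j : Fin n} (hij : i ≠ j) : P[fun ω => W.metricKernel (Z i ω, Z j ω)] = W.mu := by
  have : IsProbabilityMeasure W.letterLaw := by
    rw [← (hlaw i).map_eq]
    exact Measure.isProbabilityMeasure_map (hlaw i).aemeasurable
  rw [← W.integral_metricKernel]
  have hmap := (hind.indepFun hij).map_prod_eq_prod_map_map (hlaw i).aemeasurable
    (hlaw j).aemeasurable
  rw [(hlaw i).map_eq, (hlaw j).map_eq] at hmap
  rw [← hmap, integral_map ((hlaw i).aemeasurable.prodMk (hlaw j).aemeasurable)
    W.measurable_metricKernel.aestronglyMeasurable]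

/-- Only the `n` diagonal terms are biased, each by at most 1. -/
lemma abs_sum_sum_integral_metricKernel_sub_le (hlaw : ∀ i, HasLaw (Z i) W.letterLaw P)
    (hind : iIndepFun Z P) (hmu : W.mu ∈ Set.Icc (0 : ℝ) 1) :
    |∑ i, ∑ j, P[fun ω => W.metricKernel (Z i ω, Z j ω)] - (n : ℝ) ^ 2 * W.mu| ≤ (n : ℝ) := by
  have hmean : ∀ i, P[fun ω => W.metricKernel (Z i ω, Z i ω)] ∈ Set.Icc (0 : ℝ) 1 := fun i => by
    constructor
    · exact integral_nonneg fun ω => (W.metricKernel_mem_Icc _).1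
    · refine (integral_mono_of_nonneg (ae_of_all _ fun ω => (W.metricKernel_mem_Icc _).1)
        (integrable_const (1 : ℝ)) (ae_of_all _ fun ω => (W.metricKernel_mem_Icc _).2)).trans ?_
      simp
  have hinner : ∀ i, ∑ j, (P[fun ω => W.metricKernel (Z i ω, Z j ω)] - W.mu) =
      P[fun ω => W.metricKernel (Z i ω, Z i ω)] - W.mu := fun i =>
    Finset.sum_eq_single i
      (fun j _ hj => by rw [W.integral_metricKernel_of_ne hlaw hind hj.symm, sub_self])
      (by simp)
  have hsum : ∑ i, ∑ j, P[fun ω => W.metricKernel (Z i ω, Z j ω)] - (n : ℝ) ^ 2 * W.mu =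
      ∑ i, (P[fun ω => W.metricKernel (Z i ω, Z i ω)] - W.mu) := by
    simp only [← hinner, Finset.sum_sub_distrib, Finset.sum_const, Finset.card_univ,
      Fintype.card_fin, nsmul_eq_mul]
    ring
  rw [hsum]
  calc |∑ i, (P[fun ω => W.metricKernel (Z i ω, Z i ω)] - W.mu)|
      ≤ ∑ i, |P[fun ω => W.metricKernel (Z i ω, Z i ω)] - W.mu| :=
        Finset.abs_sum_le_sum_abs _ _
    _ ≤ ∑ _i : Fin n, (1 : ℝ) := Finset.sum_le_sum fun i _ => by
        have := hmean i
        rw [abs_le]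
        constructor <;> linarith [this.1, this.2, hmu.1, hmu.2]
    _ = n := by simp

end Concentration

end BinaryInputChannel

end ORBGRAND

theorem lemma3 (W : ORBGRAND.BinaryInputChannel)
    {Ω : Type*} [MeasurableSpace Ω] (P : Measure Ω) [IsProbabilityMeasure P]
    (n : ℕ) (hn : 0 < n)
    (X : Fin n → Ω → ℤ) (Y : Fin n → Ω → ℝ)
    (hlaw : ∀ i, HasLaw (fun ω => (X i ω, Y i ω)) W.letterLaw P)
    (hindep : iIndepFun (fun i ω => (X i ω, Y i ω)) P)
    (δ : ℝ) (hδ : 0 < δ)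
    (hsub : Set.Icc (W.mu - δ) (W.mu + δ) ⊆ Set.Ioo (0 : ℝ) (1 / 4)) :
    P.real {ω | W.metric (fun i => X i ω) (fun i => Y i ω) ∈
        Set.Icc (W.mu - δ) (W.mu + δ)}ᶜ ≤
      4 * Real.exp (-((n : ℝ) * δ ^ 2 / 2)) := by
  have hlo := (hsub (Set.left_mem_Icc.mpr (by linarith))).1
  have hhi := (hsub (Set.right_mem_Icc.mpr (by linarith))).2
  -- An interval of length `2δ` fits inside `(0, 1/4)`.
  have hδ8 : δ < 1 / 8 := by linarith
  have hn0 : (0 : ℝ) < n := Nat.cast_pos.mpr hn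
  rcases lt_or_ge δ (1 / n) with hsmall | hlarge
  · exact measureReal_le_one.trans (ORBGRAND.one_le_four_exp hn0 hδ hδ8 hsmall)
  -- The deviation left for the centred sum once the bias `1/n` is paid.
  set t : ℝ := δ - 1 / n with ht
  have ht0 : 0 ≤ t := sub_nonneg.mpr hlarge
  set S : Ω → ℝ := fun ω => ∑ i, ∑ j, (W.metricKernel ((X i ω, Y i ω), (X j ω, Y j ω)) -
    P[fun ω => W.metricKernel ((X i ω, Y i ω), (X j ω, Y j ω))]) with hS
  have hsubG : HasSubgaussianMGF S _ P :=
    ORBGRAND.hasSubgaussianMGF_sum_sum (fun i => (hlaw i).aemeasurable) hindep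
      W.measurable_metricKernel W.metricKernel_mem_Icc
  have hbias := abs_le.mp (W.abs_sum_sum_integral_metricKernel_sub_le hlaw hindep
    ⟨by linarith, by linarith⟩)
  have hmetric : ∀ ω, (n : ℝ) ^ 2 * W.metric (fun i => X i ω) (fun i => Y i ω) =
      S ω + ∑ i, ∑ j, P[fun ω => W.metricKernel ((X i ω, Y i ω), (X j ω, Y j ω))] := by
    intro ω
    rw [W.metric_eq_sum_sum, ← mul_assoc, mul_one_div_cancel (by positivity), one_mul]
    simp only [hS, Finset.sum_sub_distrib, sub_add_cancel]
  have hnt : (n : ℝ) ^ 2 * t = n ^ 2 * δ - n := by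
    rw [ht]
    field_simp
  have hcover : {ω | W.metric (fun i => X i ω) (fun i => Y i ω) ∈
      Set.Icc (W.mu - δ) (W.mu + δ)}ᶜ ⊆ {ω | (n : ℝ) ^ 2 * t ≤ S ω} ∪
        {ω | (n : ℝ) ^ 2 * t ≤ (-S) ω} := by
    intro ω hω
    by_contra hout
    simp only [Set.mem_union, Set.mem_ofPred_eq, not_or, not_le, Pi.neg_apply] at hout
    have h1 := hmetric ω
    have hsq : (0 : ℝ) < (n : ℝ) ^ 2 := by positivity
    refine hω ⟨le_of_mul_le_mul_left ?_ hsq, le_of_mul_le_mul_left ?_ hsq⟩ <;> linarith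
  have hrate : -((n : ℝ) ^ 2 * t) ^ 2 / (2 * (((n : NNReal) ^ 2 * (n / 2) : NNReal) : ℝ)) =
      -(n * t ^ 2) := by
    push_cast
    field_simp
  have hnt0 : 0 ≤ (n : ℝ) ^ 2 * t := by positivity
  calc _ ≤ P.real ({ω | (n : ℝ) ^ 2 * t ≤ S ω} ∪ {ω | (n : ℝ) ^ 2 * t ≤ (-S) ω}) :=
        measureReal_mono hcover
    _ ≤ Real.exp (-(n * t ^ 2)) + Real.exp (-(n * t ^ 2)) :=
        (measureReal_union_le _ _).trans <| by
          rw [← hrate]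
          exact add_le_add (hsubG.measure_ge_le hnt0) (hsubG.neg.measure_ge_le hnt0)
    _ = 2 * Real.exp (-(n * t ^ 2)) := by ring
    _ ≤ _ := ORBGRAND.two_exp_le_four_exp hn0 hδ8
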